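/- **Setting.** Let $\mathbb G=(L^\infty(\mathbb G),\Delta)$ be a Hopf--von Neumann algebra, i.e. a von Neumann algebra $L^\infty(\mathbb G)\subseteq B(L)$ with a unital normal $*$-homomorphism $\Delta:L^\infty(\mathbb G)\to L^\infty(\mathbb G)\,\overline\otimes\,L^\infty(\mathbb G)$ satisfying $(\Delta\otimes\iota)\Delta=(\iota\otimes\Delta)\Delta$, and let $L^1(\mathbb G)=L^\infty(\mathbb G)_*$ with the product $\theta*\varphi=(\theta\otimes\varphi)\Delta$. An *invariant mean* on $\mathbb G$ is a state $m$ of $L^\infty(\mathbb G)$ with $m((\theta\otimes\iota)\Delta(x))=\theta(1)m(x)=m((\iota\otimes\theta)\Delta(x))$ for all $x\in L^\infty(\mathbb G)$, $\theta\in L^1(\mathbb G)$. Assume that $\mathbb G$ is amenable (it has an invariant mean) and left co-amenable ($L^1(\mathbb G)$ has a bounded left approximate identity). Let $\alpha:N\to N\,\overline\otimes\,L^\infty(\mathbb G)$ be an action of $\mathbb G$ on a von Neumann algebra $N$ (a unital normal $*$-homomorphism with $(\alpha\otimes\iota)\alpha=(\iota\otimes\Delta)\alpha$), and let $\omega$ be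 a faithful normal state of $N$ with $(\omega\otimes\iota)\alpha=\omega(\cdot)1$. Assume that for some bounded left approximate identity $(\epsilon_\lambda)$ of $L^1(\mathbb G)$ one has $(\iota\otimes\epsilon_\lambda)\alpha(a)\to a$ weakly for every $a\in N$. Let $N$ act on the GNS space $\mathcal H$ of $(N,\omega)$ with GNS map $\Gamma$, and let $U\in B(\mathcal H)\,\overline\otimes\,L^\infty(\mathbb G)$ be the isometry determined by $((\iota\otimes\theta)(U))\Gamma(a)=\Gamma((\iota\otimes\theta)\alpha(a))$ for $a\in N$, $\theta\in L^1(\mathbb G)$. A vector $\zeta\in\mathcal H$ is *completely periodic* if it lies in a finite-dimensional subspace of $\mathcal H$, with projection $p$, that is invariant under $U$ (that is, $U(p\otimes1)=(p\otimes1)U(p\otimes1)$), such that the restriction $u$ of $U$ to this subspace and the transpose $u^{\mathrm t}$ are both invertible. Let $\mathcal H^{\mathrm{CAP}}$ be the closed linear span of the completely periodic vectors, let $C(\mathbb H)$ be the unital C*-subalgebra of $L^\infty(\mathbb G)$ generated by $\{(\omega_{\zeta,\eta}\otimes\iota)(U):\zeta\in\mathcal H^{\mathrm{CAP}},\ \eta\in\mathcal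 H\}$, where $\omega_{\zeta,\eta}(T)=\langle T\zeta,\eta\rangle$, and let $\mathbb H=(C(\mathbb H),\Delta|_{C(\mathbb H)})$ be the associated compactification of $\mathbb G$. **Proposition.** Suppose that $\mathbb H$ is co-commutative, i.e. $\Delta|_{C(\mathbb H)}$ is invariant under the flip of the two tensor legs (this is the case when $\mathbb H$ is the dual of a discrete group $H$, that is, when $C(\mathbb H)$ is the closed linear span of a copy $(\lambda_h)_{h\in H}$ of $H$ in its unitary group with $\Delta(\lambda_h)=\lambda_h\otimes\lambda_h$). Then for every irreducible unitary finite-dimensional co-representation $u=(u_{ij})_{i,j=1}^n\in M_n(C(\mathbb H))$ of $\mathbb H$ there exists an invariant mean $m$ on $\mathbb G$ such that for all $1\le i,j\le n$ there is $v\in C(\mathbb H)$ with $$m(x\,u_{ij})=m(v\,x)\qquad\text{for all }x\in L^\infty(\mathbb G).$$ -/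

import Mathlib

open scoped TensorProduct InnerProductSpace Topology ComplexOrder
open Filter

set_option linter.unusedSectionVars false

noncomputable section

/-! ### Hilbert space tensor products, elementary tensors of operators, vector slices -/

section HilbertTensor

/-- The Hilbert space tensor product of two Hilbert spaces. -/
abbrev HilbertTensor (H K : Type*) [NormedAddCommGroup H] [InnerProductSpace ℂ H]
    [NormedAddCommGroup K] [InnerProductSpace ℂ K] : Type _ :=
  UniformSpace.Completion (H ⊗[ℂ] K)

/-- The flip of the two legs of the Hilbert tensor square. -/
def tensorFlip (K : Type*) [NormedAddCommGroup K] [InnerProductSpace ℂ K] :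
    HilbertTensor K K →L[ℂ] HilbertTensor K K :=
  ((TensorProduct.commIsometry ℂ K K).toContinuousLinearEquiv : K ⊗[ℂ] K →L[ℂ] K ⊗[ℂ] K).completion

variable {H K : Type*}
  [NormedAddCommGroup H] [InnerProductSpace ℂ H]
  [NormedAddCommGroup K] [InnerProductSpace ℂ K]

/-- The operator `ξ ↦ ζ ⊗ ξ` from `K` to the Hilbert tensor product of `H` and `K`. -/
def insLeft (ζ : H) : K →L[ℂ] HilbertTensor H K :=
  (UniformSpace.Completion.toComplL (𝕜 := ℂ) (E := H ⊗[ℂ] K)) ∘L (TensorProduct.mkL ℂ H K ζ)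

/-- The operator `ζ ↦ ζ ⊗ ξ` from `H` to the Hilbert tensor product of `H` and `K`. -/
def insRight (ξ : K) : H →L[ℂ] HilbertTensor H K :=
  (UniformSpace.Completion.toComplL (𝕜 := ℂ) (E := H ⊗[ℂ] K)) ∘L
    ((TensorProduct.mkL ℂ H K).flip ξ)

/-- The operator `x ⊗ y` on the Hilbert tensor product. -/
def opTensor (x : H →L[ℂ] H) (y : K →L[ℂ] K) : HilbertTensor H K →L[ℂ] HilbertTensor H K :=
  (TensorProduct.mapL x y).completion

theorem insLeft_apply (ζ : H) (ξ : K) :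
    insLeft ζ ξ = ((ζ ⊗ₜ[ℂ] ξ : H ⊗[ℂ] K) : HilbertTensor H K) := rfl

theorem insRight_apply (ζ : H) (ξ : K) :
    insRight ξ ζ = ((ζ ⊗ₜ[ℂ] ξ : H ⊗[ℂ] K) : HilbertTensor H K) := rfl

theorem insLeft_add (ζ ζ' : H) :
    (insLeft (ζ + ζ') : K →L[ℂ] HilbertTensor H K) = insLeft ζ + insLeft ζ' := by
  simp [insLeft]

theorem insLeft_smul (c : ℂ) (ζ : H) :
    (insLeft (c • ζ) : K →L[ℂ] HilbertTensor H K) = c • insLeft ζ := by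
  simp [insLeft]

theorem insRight_add (ξ ξ' : K) :
    (insRight (ξ + ξ') : H →L[ℂ] HilbertTensor H K) = insRight ξ + insRight ξ' := by
  simp [insRight]

theorem insRight_smul (c : ℂ) (ξ : K) :
    (insRight (c • ξ) : H →L[ℂ] HilbertTensor H K) = c • insRight ξ := by
  simp [insRight]

theorem norm_insLeft_le (ζ : H) : ‖(insLeft ζ : K →L[ℂ] HilbertTensor H K)‖ ≤ ‖ζ‖ :=
  ContinuousLinearMap.opNorm_le_bound _ (norm_nonneg _) fun ξ => by
    rw [insLeft_apply, UniformSpace.Completion.norm_coe, TensorProduct.norm_tmul]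

theorem norm_insRight_le (ξ : K) : ‖(insRight ξ : H →L[ℂ] HilbertTensor H K)‖ ≤ ‖ξ‖ :=
  ContinuousLinearMap.opNorm_le_bound _ (norm_nonneg _) fun ζ => by
    rw [insRight_apply, UniformSpace.Completion.norm_coe, TensorProduct.norm_tmul, mul_comm]

theorem opTensor_comp_insLeft (x : H →L[ℂ] H) (y : K →L[ℂ] K) (ζ : H) :
    opTensor x y ∘L insLeft ζ = insLeft (x ζ) ∘L y := by
  ext ξ
  simp [opTensor, insLeft_apply]

theorem opTensor_comp_insRight (x : H →L[ℂ] H) (y : K →L[ℂ] K) (ξ : K) :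
    opTensor x y ∘L insRight ξ = insRight (y ξ) ∘L x := by
  ext ζ
  simp [opTensor, insRight_apply]

/-- Bounded operators on a Hilbert tensor product agree if they agree on elementary tensors. -/
theorem hilbertTensor_ext {E : Type*} [NormedAddCommGroup E] [NormedSpace ℂ E]
    {S T : HilbertTensor H K →L[ℂ] E}
    (h : ∀ (ζ : H) (ξ : K), S (insLeft ζ ξ) = T (insLeft ζ ξ)) : S = T := by
  ext z
  induction z using UniformSpace.Completion.induction_on with
  | hp => exact isClosed_eq S.continuous T.continuous
  | ih z =>
    induction z with
    | zero => rw [UniformSpace.Completion.coe_zero, map_zero, map_zero]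
    | tmul ζ ξ => exact h ζ ξ
    | add a b ha hb => simp only [UniformSpace.Completion.coe_add, map_add, ha, hb]

theorem opTensor_mul (x x' : H →L[ℂ] H) (y y' : K →L[ℂ] K) :
    opTensor x y * opTensor x' y' = opTensor (x * x') (y * y') :=
  hilbertTensor_ext fun ζ ξ => by simp [opTensor, insLeft_apply]

variable [CompleteSpace H] [CompleteSpace K]

theorem opTensor_adjoint (x : H →L[ℂ] H) (y : K →L[ℂ] K) :
    (opTensor x y).adjoint = opTensor x.adjoint y.adjoint := by
  symm
  rw [ContinuousLinearMap.eq_adjoint_iff]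
  intro z w
  induction z, w using UniformSpace.Completion.induction_on₂ with
  | hp => exact isClosed_eq (by fun_prop) (by fun_prop)
  | ih z w =>
    induction z with
    | zero => simp only [UniformSpace.Completion.coe_zero, map_zero, inner_zero_left]
    | add a b ha hb =>
      simp only [UniformSpace.Completion.coe_add, map_add, inner_add_left, ha, hb]
    | tmul ζ ξ =>
      induction w with
      | zero => simp only [UniformSpace.Completion.coe_zero, map_zero, inner_zero_right]
      | add a b ha hb =>
        simp only [UniformSpace.Completion.coe_add, map_add, inner_add_right, ha, hb]
      | tmul ζ' ξ' =>
        simp [opTensor, ContinuousLinearMap.adjoint_inner_left]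

/-- The slice `(ω_{ζ,η} ⊗ id)(X)`, where `ω_{ζ,η}(x) = ⟨x ζ, η⟩` (linear in `ζ`). -/
def vecSliceLeft (ζ η : H) (X : HilbertTensor H K →L[ℂ] HilbertTensor H K) : K →L[ℂ] K :=
  (insLeft η).adjoint ∘L X ∘L insLeft ζ

/-- The slice `(id ⊗ ω_{ξ,η})(X)`, where `ω_{ξ,η}(y) = ⟨y ξ, η⟩` (linear in `ξ`). -/
def vecSliceRight (ξ η : K) (X : HilbertTensor H K →L[ℂ] HilbertTensor H K) : H →L[ℂ] H :=
  (insRight η).adjoint ∘L X ∘L insRight ξ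

theorem norm_vecSliceLeft_le (ζ η : H) (X : HilbertTensor H K →L[ℂ] HilbertTensor H K) :
    ‖vecSliceLeft ζ η X‖ ≤ ‖X‖ * ‖ζ‖ * ‖η‖ := by
  have h1 := norm_insLeft_le (K := K) ζ
  have h2 := norm_insLeft_le (K := K) η
  calc ‖vecSliceLeft ζ η X‖ ≤ ‖(insLeft η : K →L[ℂ] HilbertTensor H K).adjoint‖ *
        (‖X‖ * ‖(insLeft ζ : K →L[ℂ] HilbertTensor H K)‖) :=
        (ContinuousLinearMap.opNorm_comp_le _ _).trans
          (mul_le_mul_of_nonneg_left (ContinuousLinearMap.opNorm_comp_le _ _) (norm_nonneg _))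
    _ ≤ ‖η‖ * (‖X‖ * ‖ζ‖) := by
        rw [LinearIsometryEquiv.norm_map]
        gcongr
    _ = ‖X‖ * ‖ζ‖ * ‖η‖ := by ring

theorem norm_vecSliceRight_le (ξ η : K) (X : HilbertTensor H K →L[ℂ] HilbertTensor H K) :
    ‖vecSliceRight ξ η X‖ ≤ ‖X‖ * ‖ξ‖ * ‖η‖ := by
  have h1 := norm_insRight_le (H := H) ξ
  have h2 := norm_insRight_le (H := H) η
  calc ‖vecSliceRight ξ η X‖ ≤ ‖(insRight η : H →L[ℂ] HilbertTensor H K).adjoint‖ *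
        (‖X‖ * ‖(insRight ξ : H →L[ℂ] HilbertTensor H K)‖) :=
        (ContinuousLinearMap.opNorm_comp_le _ _).trans
          (mul_le_mul_of_nonneg_left (ContinuousLinearMap.opNorm_comp_le _ _) (norm_nonneg _))
    _ ≤ ‖η‖ * (‖X‖ * ‖ξ‖) := by
        rw [LinearIsometryEquiv.norm_map]
        gcongr
    _ = ‖X‖ * ‖ξ‖ * ‖η‖ := by ring

theorem vecSliceLeft_mul_comm (ζ η : H) (X : HilbertTensor H K →L[ℂ] HilbertTensor H K)
    (y : K →L[ℂ] K) (h : opTensor 1 y * X = X * opTensor 1 y) :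
    y * vecSliceLeft ζ η X = vecSliceLeft ζ η X * y := by
  have e1 : y ∘L (insLeft η : K →L[ℂ] HilbertTensor H K).adjoint =
      (insLeft η).adjoint ∘L opTensor 1 y := by
    have := congrArg ContinuousLinearMap.adjoint
      (opTensor_comp_insLeft (1 : H →L[ℂ] H) y.adjoint η)
    rw [ContinuousLinearMap.adjoint_comp, ContinuousLinearMap.adjoint_comp, opTensor_adjoint,
      ContinuousLinearMap.adjoint_adjoint, ← ContinuousLinearMap.star_eq_adjoint (1 : H →L[ℂ] H),
      star_one] at this
    exact this.symm
  have e2 := opTensor_comp_insLeft (1 : H →L[ℂ] H) y ζ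
  calc y * vecSliceLeft ζ η X = (y ∘L (insLeft η).adjoint) ∘L X ∘L insLeft ζ := rfl
    _ = (insLeft η).adjoint ∘L (opTensor 1 y * X) ∘L insLeft ζ := by rw [e1]; rfl
    _ = (insLeft η).adjoint ∘L X ∘L (opTensor 1 y ∘L insLeft ζ) := by rw [h]; rfl
    _ = vecSliceLeft ζ η X * y := by rw [e2]; rfl

theorem vecSliceRight_mul_comm (ξ η : K) (X : HilbertTensor H K →L[ℂ] HilbertTensor H K)
    (x : H →L[ℂ] H) (h : opTensor x 1 * X = X * opTensor x 1) :
    x * vecSliceRight ξ η X = vecSliceRight ξ η X * x := by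
  have e1 : x ∘L (insRight η : H →L[ℂ] HilbertTensor H K).adjoint =
      (insRight η).adjoint ∘L opTensor x 1 := by
    have := congrArg ContinuousLinearMap.adjoint
      (opTensor_comp_insRight x.adjoint (1 : K →L[ℂ] K) η)
    rw [ContinuousLinearMap.adjoint_comp, ContinuousLinearMap.adjoint_comp, opTensor_adjoint,
      ContinuousLinearMap.adjoint_adjoint, ← ContinuousLinearMap.star_eq_adjoint (1 : K →L[ℂ] K),
      star_one] at this
    exact this.symm
  have e2 := opTensor_comp_insRight x (1 : K →L[ℂ] K) ξ
  calc x * vecSliceRight ξ η X = (x ∘L (insRight η).adjoint) ∘L X ∘L insRight ξ := rfl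
    _ = (insRight η).adjoint ∘L (opTensor x 1 * X) ∘L insRight ξ := by rw [e1]; rfl
    _ = (insRight η).adjoint ∘L X ∘L (opTensor x 1 ∘L insRight ξ) := by rw [h]; rfl
    _ = vecSliceRight ξ η X * x := by rw [e2]; rfl

end HilbertTensor

/-! ### Von Neumann algebras: tensor products, normal functionals and maps, slice maps -/

section VonNeumann

variable {H K : Type*}
  [NormedAddCommGroup H] [InnerProductSpace ℂ H] [CompleteSpace H]
  [NormedAddCommGroup K] [InnerProductSpace ℂ K] [CompleteSpace K]

/-- The elements of a von Neumann algebra, as a unital C*-algebra. -/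
abbrev VNElem (M : VonNeumannAlgebra H) : Type _ := M.toStarSubalgebra

instance vonNeumannAlgebra_isClosed (M : VonNeumannAlgebra H) :
    IsClosed (M.toStarSubalgebra : Set (H →L[ℂ] H)) := by
  have h : (M.toStarSubalgebra : Set (H →L[ℂ] H)) =
      Set.centralizer (Set.centralizer M.toStarSubalgebra.carrier) :=
    M.centralizer_centralizer'.symm
  rw [h]
  exact Set.isClosed_centralizer _

/-- The von Neumann algebra tensor product: the bicommutant of the elementary tensors. -/
def vnTensor (M : VonNeumannAlgebra H) (N : VonNeumannAlgebra K) :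
    VonNeumannAlgebra (HilbertTensor H K) where
  toStarSubalgebra := StarSubalgebra.centralizer ℂ
    (StarSubalgebra.centralizer ℂ {z | ∃ x ∈ M, ∃ y ∈ N, z = opTensor x y} :
      Set (HilbertTensor H K →L[ℂ] HilbertTensor H K))
  centralizer_centralizer' := by
    have h := StarSubalgebra.coe_centralizer_centralizer ℂ
      {z : HilbertTensor H K →L[ℂ] HilbertTensor H K | ∃ x ∈ M, ∃ y ∈ N, z = opTensor x y}
    change Set.centralizer (Set.centralizer (StarSubalgebra.centralizer ℂ
      (StarSubalgebra.centralizer ℂ {z | ∃ x ∈ M, ∃ y ∈ N, z = opTensor x y} :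
        Set (HilbertTensor H K →L[ℂ] HilbertTensor H K)) : Set _)) =
      (StarSubalgebra.centralizer ℂ
        (StarSubalgebra.centralizer ℂ {z | ∃ x ∈ M, ∃ y ∈ N, z = opTensor x y} :
          Set (HilbertTensor H K →L[ℂ] HilbertTensor H K)) :
        Set (HilbertTensor H K →L[ℂ] HilbertTensor H K))
    rw [h, Set.centralizer_centralizer_centralizer]

theorem vnTensor_comm {M : VonNeumannAlgebra H} {N : VonNeumannAlgebra K}
    (X : VNElem (vnTensor M N)) (z : HilbertTensor H K →L[ℂ] HilbertTensor H K)
    (hz : ∀ x ∈ M, ∀ y ∈ N, opTensor x y * z = z * opTensor x y) :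
    z * (X : HilbertTensor H K →L[ℂ] HilbertTensor H K) = X * z := by
  have hX : (X : HilbertTensor H K →L[ℂ] HilbertTensor H K) ∈ ((StarSubalgebra.centralizer ℂ
      (StarSubalgebra.centralizer ℂ {z | ∃ x ∈ M, ∃ y ∈ N, z = opTensor x y} :
        Set (HilbertTensor H K →L[ℂ] HilbertTensor H K)) : Set _)) := X.2
  rw [StarSubalgebra.coe_centralizer_centralizer] at hX
  refine hX z ?_
  rintro w (⟨x, hx, y, hy, rfl⟩ | ⟨x, hx, y, hy, hw⟩)
  · exact hz x hx y hy
  · have hw' : w = opTensor (star x) (star y) := by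
      rw [← star_star w, hw, ContinuousLinearMap.star_eq_adjoint, opTensor_adjoint]
      rfl
    rw [hw']
    exact hz _ (star_mem hx) _ (star_mem hy)

theorem vnTensor_comm_left {M : VonNeumannAlgebra H} {N : VonNeumannAlgebra K}
    (X : VNElem (vnTensor M N)) (x : H →L[ℂ] H) (hx : x ∈ M.commutant) :
    opTensor x 1 * (X : HilbertTensor H K →L[ℂ] HilbertTensor H K) =
      (X : HilbertTensor H K →L[ℂ] HilbertTensor H K) * opTensor x 1 :=
  vnTensor_comm X _ fun a ha b _ => by
    rw [opTensor_mul, opTensor_mul, mul_one, one_mul,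
      VonNeumannAlgebra.mem_commutant_iff.1 hx a ha]

theorem vnTensor_comm_right {M : VonNeumannAlgebra H} {N : VonNeumannAlgebra K}
    (X : VNElem (vnTensor M N)) (y : K →L[ℂ] K) (hy : y ∈ N.commutant) :
    opTensor 1 y * (X : HilbertTensor H K →L[ℂ] HilbertTensor H K) =
      (X : HilbertTensor H K →L[ℂ] HilbertTensor H K) * opTensor 1 y :=
  vnTensor_comm X _ fun a _ b hb => by
    rw [opTensor_mul, opTensor_mul, mul_one, one_mul,
      VonNeumannAlgebra.mem_commutant_iff.1 hy b hb]

theorem mem_of_comm_commutant (M : VonNeumannAlgebra H) (x : H →L[ℂ] H)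
    (h : ∀ y ∈ M.commutant, y * x = x * y) : x ∈ M.toStarSubalgebra := by
  have : x ∈ M.commutant.commutant := VonNeumannAlgebra.mem_commutant_iff.2 h
  rwa [VonNeumannAlgebra.commutant_commutant] at this

/-- `(ω_{ζ,η} ⊗ id)(X)` as an element of the second factor. -/
def sliceLeftVec {M : VonNeumannAlgebra H} {N : VonNeumannAlgebra K} (ζ η : H)
    (X : VNElem (vnTensor M N)) : VNElem N :=
  ⟨vecSliceLeft ζ η X, mem_of_comm_commutant N _ fun y hy =>
    vecSliceLeft_mul_comm ζ η _ y (vnTensor_comm_right X y hy)⟩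

/-- `(id ⊗ ω_{ξ,η})(X)` as an element of the first factor. -/
def sliceRightVec {M : VonNeumannAlgebra H} {N : VonNeumannAlgebra K} (ξ η : K)
    (X : VNElem (vnTensor M N)) : VNElem M :=
  ⟨vecSliceRight ξ η X, mem_of_comm_commutant M _ fun x hx =>
    vecSliceRight_mul_comm ξ η _ x (vnTensor_comm_left X x hx)⟩

theorem sliceLeftVec_add_left {M : VonNeumannAlgebra H} {N : VonNeumannAlgebra K} (ζ ζ' η : H)
    (X : VNElem (vnTensor M N)) :
    sliceLeftVec (ζ + ζ') η X = sliceLeftVec ζ η X + sliceLeftVec ζ' η X := by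
  ext v
  simp [sliceLeftVec, vecSliceLeft, insLeft_add]

theorem sliceLeftVec_smul_left {M : VonNeumannAlgebra H} {N : VonNeumannAlgebra K} (c : ℂ) (ζ η : H)
    (X : VNElem (vnTensor M N)) :
    sliceLeftVec (c • ζ) η X = c • sliceLeftVec ζ η X := by
  ext v
  simp [sliceLeftVec, vecSliceLeft, insLeft_smul]

theorem sliceLeftVec_add_right {M : VonNeumannAlgebra H} {N : VonNeumannAlgebra K} (ζ η η' : H)
    (X : VNElem (vnTensor M N)) :
    sliceLeftVec ζ (η + η') X = sliceLeftVec ζ η X + sliceLeftVec ζ η' X := by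
  ext v
  simp [sliceLeftVec, vecSliceLeft, insLeft_add]

theorem sliceLeftVec_smul_right {M : VonNeumannAlgebra H} {N : VonNeumannAlgebra K} (c : ℂ) (ζ η : H)
    (X : VNElem (vnTensor M N)) :
    sliceLeftVec ζ (c • η) X = starRingEnd ℂ c • sliceLeftVec ζ η X := by
  ext v
  simp [sliceLeftVec, vecSliceLeft, insLeft_smul, map_smulₛₗ]

theorem sliceLeftVec_commutant {M : VonNeumannAlgebra H} {N : VonNeumannAlgebra K} (ζ η : H)
    (X : VNElem (vnTensor M N)) (y : H →L[ℂ] H) (hy : y ∈ M.commutant) :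
    sliceLeftVec ζ (y.adjoint η) X = sliceLeftVec (y ζ) η X := by
  have e1 : (insLeft (y.adjoint η) : K →L[ℂ] HilbertTensor H K).adjoint =
      (insLeft η).adjoint ∘L opTensor y 1 := by
    have := congrArg ContinuousLinearMap.adjoint
      (opTensor_comp_insLeft y.adjoint (1 : K →L[ℂ] K) η)
    rw [ContinuousLinearMap.adjoint_comp, ContinuousLinearMap.adjoint_comp, opTensor_adjoint,
      ContinuousLinearMap.adjoint_adjoint, ← ContinuousLinearMap.star_eq_adjoint (1 : K →L[ℂ] K),
      star_one] at this
    exact this.symm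
  have e2 := opTensor_comp_insLeft y (1 : K →L[ℂ] K) ζ
  have e3 := vnTensor_comm_left X y hy
  apply Subtype.ext
  calc vecSliceLeft ζ (y.adjoint η) (X : HilbertTensor H K →L[ℂ] HilbertTensor H K)
      = (insLeft η).adjoint ∘L (opTensor y 1 * (X : HilbertTensor H K →L[ℂ] HilbertTensor H K)) ∘L
          insLeft ζ := by rw [vecSliceLeft, e1]; rfl
    _ = (insLeft η).adjoint ∘L (X : HilbertTensor H K →L[ℂ] HilbertTensor H K) ∘L
          (opTensor y 1 ∘L insLeft ζ) := by rw [e3]; rfl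
    _ = vecSliceLeft (y ζ) η (X : HilbertTensor H K →L[ℂ] HilbertTensor H K) := by rw [e2]; rfl

/-- The bounded sesquilinear form sending `(ζ, η)` to the conjugate of `θ((ω_{ζ,η} ⊗ id)(X))`. -/
def sliceRightForm {M : VonNeumannAlgebra H} {N : VonNeumannAlgebra K}
    (θ : StrongDual ℂ (VNElem N)) (X : VNElem (vnTensor M N)) : H →L⋆[ℂ] H →L[ℂ] ℂ :=
  LinearMap.mkContinuous₂
    (LinearMap.mk₂'ₛₗ (starRingEnd ℂ) (RingHom.id ℂ)
      (fun ζ η => starRingEnd ℂ (θ (sliceLeftVec ζ η X)))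
      (fun ζ ζ' η => by simp only [sliceLeftVec_add_left, map_add])
      (fun c ζ η => by simp only [sliceLeftVec_smul_left, map_smul, smul_eq_mul, map_mul])
      (fun ζ η η' => by simp only [sliceLeftVec_add_right, map_add])
      (fun c ζ η => by
        simp only [sliceLeftVec_smul_right, map_smul, smul_eq_mul, map_mul, RingHom.id_apply,
          RCLike.conj_conj]))
    (‖θ‖ * ‖X‖)
    (fun ζ η => by
      have h1 : ‖sliceLeftVec ζ η X‖ ≤ ‖X‖ * ‖ζ‖ * ‖η‖ := norm_vecSliceLeft_le ζ η _
      calc ‖starRingEnd ℂ (θ (sliceLeftVec ζ η X))‖ = ‖θ (sliceLeftVec ζ η X)‖ :=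
            RCLike.norm_conj _
        _ ≤ ‖θ‖ * (‖X‖ * ‖ζ‖ * ‖η‖) := (θ.le_opNorm _).trans (by gcongr)
        _ = ‖θ‖ * ‖X‖ * ‖ζ‖ * ‖η‖ := by ring)

theorem inner_sliceRightForm {M : VonNeumannAlgebra H} {N : VonNeumannAlgebra K}
    (θ : StrongDual ℂ (VNElem N)) (X : VNElem (vnTensor M N)) (ζ η : H) :
    ⟪η, InnerProductSpace.continuousLinearMapOfBilin (sliceRightForm θ X) ζ⟫_ℂ =
      θ (sliceLeftVec ζ η X) := by
  rw [← inner_conj_symm, InnerProductSpace.continuousLinearMapOfBilin_apply]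
  simp [sliceRightForm]

/-- The slice map `(id ⊗ θ)`: the operator `T` with `⟨T ζ, η⟩ = θ((ω_{ζ,η} ⊗ id)(X))`
for all vectors `ζ`, `η`. -/
def sliceRight {M : VonNeumannAlgebra H} {N : VonNeumannAlgebra K}
    (θ : StrongDual ℂ (VNElem N)) (X : VNElem (vnTensor M N)) : VNElem M :=
  ⟨InnerProductSpace.continuousLinearMapOfBilin (sliceRightForm θ X),
    mem_of_comm_commutant M _ fun y hy => by
      refine ContinuousLinearMap.ext fun ζ => ext_inner_left ℂ fun η => ?_
      rw [mul_apply_eq_comp, mul_apply_eq_comp,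
        ← ContinuousLinearMap.adjoint_inner_left, inner_sliceRightForm, inner_sliceRightForm,
        sliceLeftVec_commutant _ _ X y hy]⟩

theorem inner_sliceRight {M : VonNeumannAlgebra H} {N : VonNeumannAlgebra K}
    (θ : StrongDual ℂ (VNElem N)) (X : VNElem (vnTensor M N)) (ζ η : H) :
    ⟪η, (sliceRight θ X : H →L[ℂ] H) ζ⟫_ℂ = θ (sliceLeftVec ζ η X) :=
  inner_sliceRightForm θ X ζ η

theorem sliceRightVec_add_left {M : VonNeumannAlgebra H} {N : VonNeumannAlgebra K} (ξ ξ' η : K)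
    (X : VNElem (vnTensor M N)) :
    sliceRightVec (ξ + ξ') η X = sliceRightVec ξ η X + sliceRightVec ξ' η X := by
  ext v
  simp [sliceRightVec, vecSliceRight, insRight_add]

theorem sliceRightVec_smul_left {M : VonNeumannAlgebra H} {N : VonNeumannAlgebra K} (c : ℂ) (ξ η : K)
    (X : VNElem (vnTensor M N)) :
    sliceRightVec (c • ξ) η X = c • sliceRightVec ξ η X := by
  ext v
  simp [sliceRightVec, vecSliceRight, insRight_smul]

theorem sliceRightVec_add_right {M : VonNeumannAlgebra H} {N : VonNeumannAlgebra K} (ξ η η' : K)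
    (X : VNElem (vnTensor M N)) :
    sliceRightVec ξ (η + η') X = sliceRightVec ξ η X + sliceRightVec ξ η' X := by
  ext v
  simp [sliceRightVec, vecSliceRight, insRight_add]

theorem sliceRightVec_smul_right {M : VonNeumannAlgebra H} {N : VonNeumannAlgebra K} (c : ℂ) (ξ η : K)
    (X : VNElem (vnTensor M N)) :
    sliceRightVec ξ (c • η) X = starRingEnd ℂ c • sliceRightVec ξ η X := by
  ext v
  simp [sliceRightVec, vecSliceRight, insRight_smul, map_smulₛₗ]

theorem sliceRightVec_commutant {M : VonNeumannAlgebra H} {N : VonNeumannAlgebra K} (ξ η : K)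
    (X : VNElem (vnTensor M N)) (y : K →L[ℂ] K) (hy : y ∈ N.commutant) :
    sliceRightVec ξ (y.adjoint η) X = sliceRightVec (y ξ) η X := by
  have e1 : (insRight (y.adjoint η) : H →L[ℂ] HilbertTensor H K).adjoint =
      (insRight η).adjoint ∘L opTensor 1 y := by
    have := congrArg ContinuousLinearMap.adjoint
      (opTensor_comp_insRight (1 : H →L[ℂ] H) y.adjoint η)
    rw [ContinuousLinearMap.adjoint_comp, ContinuousLinearMap.adjoint_comp, opTensor_adjoint,
      ContinuousLinearMap.adjoint_adjoint, ← ContinuousLinearMap.star_eq_adjoint (1 : H →L[ℂ] H),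
      star_one] at this
    exact this.symm
  have e2 := opTensor_comp_insRight (1 : H →L[ℂ] H) y ξ
  have e3 := vnTensor_comm_right X y hy
  apply Subtype.ext
  calc vecSliceRight ξ (y.adjoint η) (X : HilbertTensor H K →L[ℂ] HilbertTensor H K)
      = (insRight η).adjoint ∘L (opTensor 1 y * (X : HilbertTensor H K →L[ℂ] HilbertTensor H K)) ∘L
          insRight ξ := by rw [vecSliceRight, e1]; rfl
    _ = (insRight η).adjoint ∘L (X : HilbertTensor H K →L[ℂ] HilbertTensor H K) ∘L
          (opTensor 1 y ∘L insRight ξ) := by rw [e3]; rfl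
    _ = vecSliceRight (y ξ) η (X : HilbertTensor H K →L[ℂ] HilbertTensor H K) := by rw [e2]; rfl

/-- The bounded sesquilinear form sending `(ξ, η)` to the conjugate of `θ((id ⊗ ω_{ξ,η})(X))`. -/
def sliceLeftForm {M : VonNeumannAlgebra H} {N : VonNeumannAlgebra K}
    (θ : StrongDual ℂ (VNElem M)) (X : VNElem (vnTensor M N)) : K →L⋆[ℂ] K →L[ℂ] ℂ :=
  LinearMap.mkContinuous₂
    (LinearMap.mk₂'ₛₗ (starRingEnd ℂ) (RingHom.id ℂ)
      (fun ξ η => starRingEnd ℂ (θ (sliceRightVec ξ η X)))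
      (fun ξ ξ' η => by simp only [sliceRightVec_add_left, map_add])
      (fun c ξ η => by simp only [sliceRightVec_smul_left, map_smul, smul_eq_mul, map_mul])
      (fun ξ η η' => by simp only [sliceRightVec_add_right, map_add])
      (fun c ξ η => by
        simp only [sliceRightVec_smul_right, map_smul, smul_eq_mul, map_mul, RingHom.id_apply,
          RCLike.conj_conj]))
    (‖θ‖ * ‖X‖)
    (fun ξ η => by
      have h1 : ‖sliceRightVec ξ η X‖ ≤ ‖X‖ * ‖ξ‖ * ‖η‖ := norm_vecSliceRight_le ξ η _
      calc ‖starRingEnd ℂ (θ (sliceRightVec ξ η X))‖ = ‖θ (sliceRightVec ξ η X)‖ :=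
            RCLike.norm_conj _
        _ ≤ ‖θ‖ * (‖X‖ * ‖ξ‖ * ‖η‖) := (θ.le_opNorm _).trans (by gcongr)
        _ = ‖θ‖ * ‖X‖ * ‖ξ‖ * ‖η‖ := by ring)

theorem inner_sliceLeftForm {M : VonNeumannAlgebra H} {N : VonNeumannAlgebra K}
    (θ : StrongDual ℂ (VNElem M)) (X : VNElem (vnTensor M N)) (ξ η : K) :
    ⟪η, InnerProductSpace.continuousLinearMapOfBilin (sliceLeftForm θ X) ξ⟫_ℂ =
      θ (sliceRightVec ξ η X) := by
  rw [← inner_conj_symm, InnerProductSpace.continuousLinearMapOfBilin_apply]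
  simp [sliceLeftForm]

/-- The slice map `(θ ⊗ id)`: the operator `T` with `⟨T ξ, η⟩ = θ((id ⊗ ω_{ξ,η})(X))`
for all vectors `ξ`, `η`. -/
def sliceLeft {M : VonNeumannAlgebra H} {N : VonNeumannAlgebra K}
    (θ : StrongDual ℂ (VNElem M)) (X : VNElem (vnTensor M N)) : VNElem N :=
  ⟨InnerProductSpace.continuousLinearMapOfBilin (sliceLeftForm θ X),
    mem_of_comm_commutant N _ fun y hy => by
      refine ContinuousLinearMap.ext fun ξ => ext_inner_left ℂ fun η => ?_
      rw [mul_apply_eq_comp, mul_apply_eq_comp,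
        ← ContinuousLinearMap.adjoint_inner_left, inner_sliceLeftForm, inner_sliceLeftForm,
        sliceRightVec_commutant _ _ X y hy]⟩

theorem inner_sliceLeft {M : VonNeumannAlgebra H} {N : VonNeumannAlgebra K}
    (θ : StrongDual ℂ (VNElem M)) (X : VNElem (vnTensor M N)) (ξ η : K) :
    ⟪η, (sliceLeft θ X : K →L[ℂ] K) ξ⟫_ℂ = θ (sliceRightVec ξ η X) :=
  inner_sliceLeftForm θ X ξ η

theorem sliceRight_add {M : VonNeumannAlgebra H} {N : VonNeumannAlgebra K}
    (θ : StrongDual ℂ (VNElem N)) (X Y : VNElem (vnTensor M N)) :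
    sliceRight θ (X + Y) = sliceRight θ X + sliceRight θ Y := by
  have h : ∀ ζ η : H, sliceLeftVec ζ η (X + Y) = sliceLeftVec ζ η X + sliceLeftVec ζ η Y :=
    fun ζ η => by ext v; simp [sliceLeftVec, vecSliceLeft]
  refine Subtype.ext (ContinuousLinearMap.ext fun ζ => ext_inner_left ℂ fun η => ?_)
  change _ = ⟪η, (sliceRight θ X : H →L[ℂ] H) ζ + (sliceRight θ Y : H →L[ℂ] H) ζ⟫_ℂ
  rw [inner_add_right, inner_sliceRight, inner_sliceRight, inner_sliceRight, h, map_add]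

theorem sliceRight_smul {M : VonNeumannAlgebra H} {N : VonNeumannAlgebra K}
    (θ : StrongDual ℂ (VNElem N)) (c : ℂ) (X : VNElem (vnTensor M N)) :
    sliceRight θ (c • X) = c • sliceRight θ X := by
  have h : ∀ ζ η : H, sliceLeftVec ζ η (c • X) = c • sliceLeftVec ζ η X :=
    fun ζ η => by ext v; simp [sliceLeftVec, vecSliceLeft]
  refine Subtype.ext (ContinuousLinearMap.ext fun ζ => ext_inner_left ℂ fun η => ?_)
  change _ = ⟪η, c • (sliceRight θ X : H →L[ℂ] H) ζ⟫_ℂ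
  rw [inner_smul_right, inner_sliceRight, inner_sliceRight, h, map_smul, smul_eq_mul]

theorem norm_sliceRight_le {M : VonNeumannAlgebra H} {N : VonNeumannAlgebra K}
    (θ : StrongDual ℂ (VNElem N)) (X : VNElem (vnTensor M N)) :
    ‖sliceRight θ X‖ ≤ ‖θ‖ * ‖X‖ := by
  refine ContinuousLinearMap.opNorm_le_bound (sliceRight θ X : H →L[ℂ] H) (by positivity)
    fun ζ => ?_
  by_cases h0 : (sliceRight θ X : H →L[ℂ] H) ζ = 0
  · rw [h0, norm_zero]; positivity
  set w := (sliceRight θ X : H →L[ℂ] H) ζ with hw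
  have h1 : ‖w‖ * ‖w‖ = ‖θ (sliceLeftVec ζ w X)‖ := by
    rw [← inner_sliceRight, ← hw, inner_self_eq_norm_sq_to_K]
    simp [sq]
  have h2 : ‖θ (sliceLeftVec ζ w X)‖ ≤ ‖θ‖ * (‖X‖ * ‖ζ‖ * ‖w‖) :=
    (θ.le_opNorm _).trans (mul_le_mul_of_nonneg_left (norm_vecSliceLeft_le ζ w _) (norm_nonneg _))
  have h3 : 0 < ‖w‖ := norm_pos_iff.2 h0
  refine le_of_mul_le_mul_right ?_ h3
  calc ‖w‖ * ‖w‖ ≤ ‖θ‖ * (‖X‖ * ‖ζ‖ * ‖w‖) := h1 ▸ h2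
    _ = ‖θ‖ * ‖X‖ * ‖ζ‖ * ‖w‖ := by ring

/-- The slice map `id ⊗ θ` as a bounded linear map. -/
def sliceRightL {M : VonNeumannAlgebra H} {N : VonNeumannAlgebra K}
    (θ : StrongDual ℂ (VNElem N)) : VNElem (vnTensor M N) →L[ℂ] VNElem M :=
  LinearMap.mkContinuous
    { toFun := sliceRight θ
      map_add' := sliceRight_add θ
      map_smul' := sliceRight_smul θ } ‖θ‖ (norm_sliceRight_le θ)

/-- Normal functionals `θ = ∑ₙ ω_{ξₙ,ηₙ}` with `∑ₙ ‖ξₙ‖² < ∞` and `∑ₙ ‖ηₙ‖² < ∞`, that is, the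
`σ`-weakly continuous ones. They form the predual of the von Neumann algebra. -/
def IsNormalFunctional {M : VonNeumannAlgebra H} (θ : StrongDual ℂ (VNElem M)) : Prop :=
  ∃ ξ η : ℕ → H, Summable (fun n => ‖ξ n‖ ^ 2) ∧ Summable (fun n => ‖η n‖ ^ 2) ∧
    ∀ x : VNElem M, HasSum (fun n => ⟪η n, (x : H →L[ℂ] H) (ξ n)⟫_ℂ) (θ x)

/-- A unital *-homomorphism of von Neumann algebras as a bounded linear map. -/
def starAlgHomL {M : VonNeumannAlgebra H} {N : VonNeumannAlgebra K}
    (φ : VNElem M →⋆ₐ[ℂ] VNElem N) : VNElem M →L[ℂ] VNElem N :=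
  LinearMap.mkContinuous φ.toAlgHom.toLinearMap 1 fun x => by
    rw [one_mul]; exact NonUnitalStarAlgHom.norm_apply_le φ x

/-- Normality of a unital *-homomorphism: it pulls normal functionals back to normal functionals,
that is, it is continuous for the `σ`-weak topologies. -/
def IsNormalHom {M : VonNeumannAlgebra H} {N : VonNeumannAlgebra K}
    (φ : VNElem M →⋆ₐ[ℂ] VNElem N) : Prop :=
  ∀ θ : StrongDual ℂ (VNElem N), IsNormalFunctional θ →
    IsNormalFunctional (θ ∘L starAlgHomL φ)

end VonNeumann

/-! ### Hopf--von Neumann algebras -/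

/-- A Hopf--von Neumann algebra `𝔾 = (L^∞(𝔾), Δ)`, with `L^∞(𝔾)` acting on a Hilbert space `L`.
Co-associativity `(Δ ⊗ id)Δ = (id ⊗ Δ)Δ` is expressed by applying the (separating) slice maps
`θ₁ ⊗ id ⊗ θ₂` to both sides: one has `(θ₁ ⊗ id ⊗ θ₂)(id ⊗ Δ)(X) = (id ⊗ θ₂)Δ((θ₁ ⊗ id)(X))` and
`(θ₁ ⊗ id ⊗ θ₂)(Δ ⊗ id)(X) = (θ₁ ⊗ id)Δ((id ⊗ θ₂)(X))`. -/
structure HopfVonNeumannAlgebra (L : Type*) [NormedAddCommGroup L] [InnerProductSpace ℂ L]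
    [CompleteSpace L] where
  /-- the von Neumann algebra `L^∞(𝔾)` -/
  Linf : VonNeumannAlgebra L
  /-- the co-multiplication -/
  Δ : VNElem Linf →⋆ₐ[ℂ] VNElem (vnTensor Linf Linf)
  normal : IsNormalHom Δ
  coassoc : ∀ θ₁ θ₂ : StrongDual ℂ (VNElem Linf), IsNormalFunctional θ₁ → IsNormalFunctional θ₂ →
    ∀ x : VNElem Linf,
      sliceRight θ₂ (Δ (sliceLeft θ₁ (Δ x))) = sliceLeft θ₁ (Δ (sliceRight θ₂ (Δ x)))

namespace HopfVonNeumannAlgebra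

variable {L : Type*} [NormedAddCommGroup L] [InnerProductSpace ℂ L] [CompleteSpace L]
  (𝔾 : HopfVonNeumannAlgebra L)

/-- The convolution `(θ * φ)(x) = (θ ⊗ φ)Δ(x) = θ((id ⊗ φ)Δ(x))`. -/
def conv (θ φ : StrongDual ℂ (VNElem 𝔾.Linf)) : StrongDual ℂ (VNElem 𝔾.Linf) :=
  θ ∘L sliceRightL φ ∘L starAlgHomL 𝔾.Δ

/-- A (two-sided) invariant mean on `𝔾`. -/
structure IsInvariantMean (m : StrongDual ℂ (VNElem 𝔾.Linf)) : Prop where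
  map_one : m 1 = 1
  nonneg : ∀ x, 0 ≤ m (star x * x)
  left_invariant : ∀ θ : StrongDual ℂ (VNElem 𝔾.Linf), IsNormalFunctional θ →
    ∀ x, m (sliceLeft θ (𝔾.Δ x)) = θ 1 * m x
  right_invariant : ∀ θ : StrongDual ℂ (VNElem 𝔾.Linf), IsNormalFunctional θ →
    ∀ x, m (sliceRight θ (𝔾.Δ x)) = θ 1 * m x

/-- Amenability: existence of an invariant mean. -/
def IsAmenable : Prop := ∃ m, 𝔾.IsInvariantMean m

/-- A bounded left approximate identity of the Banach algebra `L^1(𝔾)` of normal functionals,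
given by a filter (equivalently, a net). -/
structure IsBoundedLeftApproxIdentity (F : Filter (StrongDual ℂ (VNElem 𝔾.Linf))) : Prop where
  neBot : F.NeBot
  normal : ∀ᶠ ε in F, IsNormalFunctional ε
  bounded : ∃ C : ℝ, ∀ᶠ ε in F, ‖ε‖ ≤ C
  tendsto : ∀ θ : StrongDual ℂ (VNElem 𝔾.Linf), IsNormalFunctional θ →
    Tendsto (fun ε => 𝔾.conv ε θ) F (𝓝 θ)

/-- (Left) co-amenability. -/
def IsCoamenable : Prop := ∃ F, 𝔾.IsBoundedLeftApproxIdentity F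

/-- A matrix `u ∈ M_n ⊗ L^∞(𝔾)` is a co-representation: `(id ⊗ Δ)(u) = u₁₂ u₁₃`, that is,
`Δ(u_ij) = ∑ₖ u_ik ⊗ u_kj`. -/
def IsCorepresentation {n : ℕ} (u : Matrix (Fin n) (Fin n) (VNElem 𝔾.Linf)) : Prop :=
  ∀ i j, (𝔾.Δ (u i j) : HilbertTensor L L →L[ℂ] HilbertTensor L L) =
    ∑ k, opTensor (u i k : L →L[ℂ] L) (u k j : L →L[ℂ] L)

/-- Irreducibility of a matrix co-representation `u`: the only subspaces of `ℂⁿ ≠ 0` that are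
invariant, in the sense that the projection `p` satisfies `u(p ⊗ 1) = (p ⊗ 1)u(p ⊗ 1)`, are the
trivial ones. -/
def IsIrreducible {n : ℕ} (u : Matrix (Fin n) (Fin n) (VNElem 𝔾.Linf)) : Prop :=
  0 < n ∧ ∀ p : Matrix (Fin n) (Fin n) ℂ, IsStarProjection p →
    u * p.map (algebraMap ℂ (VNElem 𝔾.Linf)) =
      p.map (algebraMap ℂ (VNElem 𝔾.Linf)) * u * p.map (algebraMap ℂ (VNElem 𝔾.Linf)) →
    p = 0 ∨ p = 1

end HopfVonNeumannAlgebra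

/-! ### State-preserving actions and complete almost periodicity -/

/-- An action `α` of `𝔾` on a von Neumann algebra `N` with an invariant faithful normal state `ω`.
The algebra `N` acts on the GNS Hilbert space `H` of `(N, ω)`; `Ω = Γ(1)` is the GNS vector, so that
`Γ(a) = aΩ` and `ω(a) = ⟨aΩ, Ω⟩`, and faithfulness of `ω` means that `Ω` is separating.
The identity `(α ⊗ id)α = (id ⊗ Δ)α` is expressed by applying the slice maps `ρ ⊗ id ⊗ θ`. -/
structure StatePreservingAction {L : Type*} [NormedAddCommGroup L] [InnerProductSpace ℂ L]
    [CompleteSpace L] (𝔾 : HopfVonNeumannAlgebra L) (H : Type*) [NormedAddCommGroup H]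
    [InnerProductSpace ℂ H] [CompleteSpace H] where
  /-- the von Neumann algebra acted upon -/
  N : VonNeumannAlgebra H
  /-- the GNS vector of the state -/
  Ω : H
  norm_Ω : ‖Ω‖ = 1
  cyclic : DenseRange (fun a : VNElem N => (a : H →L[ℂ] H) Ω)
  separating : ∀ a : VNElem N, (a : H →L[ℂ] H) Ω = 0 → a = 0
  /-- the action -/
  α : VNElem N →⋆ₐ[ℂ] VNElem (vnTensor N 𝔾.Linf)
  normal : IsNormalHom α
  action : ∀ (ρ : StrongDual ℂ (VNElem N)) (θ : StrongDual ℂ (VNElem 𝔾.Linf)),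
    IsNormalFunctional ρ → IsNormalFunctional θ → ∀ a : VNElem N,
      sliceLeft ρ (α (sliceRight θ (α a))) = sliceRight θ (𝔾.Δ (sliceLeft ρ (α a)))
  /-- invariance of the state: `(ω ⊗ id)α(a) = ω(a)1` -/
  invariant : ∀ a : VNElem N,
    sliceLeftVec Ω Ω (α a) = ⟪Ω, (a : H →L[ℂ] H) Ω⟫_ℂ • (1 : VNElem 𝔾.Linf)

namespace StatePreservingAction

variable {L : Type*} [NormedAddCommGroup L] [InnerProductSpace ℂ L] [CompleteSpace L]
  {𝔾 : HopfVonNeumannAlgebra L} {H : Type*} [NormedAddCommGroup H] [InnerProductSpace ℂ H]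
  [CompleteSpace H] (𝔸 : StatePreservingAction 𝔾 H)

/-- For some bounded left approximate identity `(ε)` of `L^1(𝔾)`, one has `(id ⊗ ε)α(a) → a` weakly
for every `a ∈ N`. -/
def IsApproximatelyUnital : Prop :=
  ∃ F, 𝔾.IsBoundedLeftApproxIdentity F ∧ ∀ (a : VNElem 𝔸.N) (ζ η : H),
    Tendsto (fun ε => ⟪η, (sliceRight ε (𝔸.α a) : H →L[ℂ] H) ζ⟫_ℂ) F
      (𝓝 ⟪η, (a : H →L[ℂ] H) ζ⟫_ℂ)

/-- The linear map `a ⊗ ξ ↦ Γ(a) ⊗ ξ` on the algebraic tensor product. -/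
def gnsTensor : (VNElem 𝔸.N ⊗[ℂ] L) →ₗ[ℂ] HilbertTensor H L :=
  TensorProduct.lift (LinearMap.mk₂ ℂ
    (fun (a : VNElem 𝔸.N) (ξ : L) => insLeft ((a : H →L[ℂ] H) 𝔸.Ω) ξ)
    (fun a b ξ => by simp [insLeft_add]) (fun c a ξ => by simp [insLeft_smul])
    (fun a ξ ξ' => by simp) (fun c a ξ => by simp))

/-- The linear map `a ⊗ ξ ↦ α(a)(Γ(1) ⊗ ξ)` on the algebraic tensor product. -/
def gnsTensorAction : (VNElem 𝔸.N ⊗[ℂ] L) →ₗ[ℂ] HilbertTensor H L :=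
  TensorProduct.lift (LinearMap.mk₂ ℂ
    (fun (a : VNElem 𝔸.N) (ξ : L) =>
      (𝔸.α a : HilbertTensor H L →L[ℂ] HilbertTensor H L) (insLeft 𝔸.Ω ξ))
    (fun a b ξ => by simp) (fun c a ξ => by simp)
    (fun a ξ ξ' => by simp) (fun c a ξ => by simp))

/-- The canonical isometry `U` on the Hilbert tensor product of `H` and `L` implementing the action,
determined by `U(Γ(a) ⊗ ξ) = α(a)(Γ(1) ⊗ ξ)`; equivalently by
`(id ⊗ θ)(U)Γ(a) = Γ((id ⊗ θ)α(a))`. -/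
def U : HilbertTensor H L →L[ℂ] HilbertTensor H L :=
  𝔸.gnsTensorAction.extendOfNorm 𝔸.gnsTensor

theorem inner_action (a b : VNElem 𝔸.N) (ξ ξ' : L) :
    ⟪(𝔸.α b : HilbertTensor H L →L[ℂ] HilbertTensor H L) (insLeft 𝔸.Ω ξ'),
      (𝔸.α a : HilbertTensor H L →L[ℂ] HilbertTensor H L) (insLeft 𝔸.Ω ξ)⟫_ℂ =
    ⟪(insLeft ((b : H →L[ℂ] H) 𝔸.Ω) ξ' : HilbertTensor H L),
      insLeft ((a : H →L[ℂ] H) 𝔸.Ω) ξ⟫_ℂ := by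
  have h := congrArg (fun z : VNElem 𝔾.Linf => ⟪ξ', (z : L →L[ℂ] L) ξ⟫_ℂ)
    (𝔸.invariant (star b * a))
  have h1 : ⟪ξ', (sliceLeftVec 𝔸.Ω 𝔸.Ω (𝔸.α (star b * a)) : L →L[ℂ] L) ξ⟫_ℂ =
      ⟪(𝔸.α b : HilbertTensor H L →L[ℂ] HilbertTensor H L) (insLeft 𝔸.Ω ξ'),
        (𝔸.α a : HilbertTensor H L →L[ℂ] HilbertTensor H L) (insLeft 𝔸.Ω ξ)⟫_ℂ := by
    change ⟪ξ', (insLeft 𝔸.Ω).adjoint ((𝔸.α (star b * a) :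
      HilbertTensor H L →L[ℂ] HilbertTensor H L) (insLeft 𝔸.Ω ξ))⟫_ℂ = _
    rw [ContinuousLinearMap.adjoint_inner_right, map_mul, map_star]
    change ⟪_, (𝔸.α b : HilbertTensor H L →L[ℂ] HilbertTensor H L).adjoint
      ((𝔸.α a : HilbertTensor H L →L[ℂ] HilbertTensor H L) (insLeft 𝔸.Ω ξ))⟫_ℂ = _
    rw [ContinuousLinearMap.adjoint_inner_right]
  have h2 : ⟪𝔸.Ω, ((star b * a : VNElem 𝔸.N) : H →L[ℂ] H) 𝔸.Ω⟫_ℂ =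
      ⟪(b : H →L[ℂ] H) 𝔸.Ω, (a : H →L[ℂ] H) 𝔸.Ω⟫_ℂ := by
    change ⟪𝔸.Ω, (b : H →L[ℂ] H).adjoint ((a : H →L[ℂ] H) 𝔸.Ω)⟫_ℂ = _
    rw [ContinuousLinearMap.adjoint_inner_right]
  rw [← h1, h, insLeft_apply, insLeft_apply, UniformSpace.Completion.inner_coe,
    TensorProduct.inner_tmul, ← h2]
  change ⟪ξ', ⟪𝔸.Ω, ((star b * a : VNElem 𝔸.N) : H →L[ℂ] H) 𝔸.Ω⟫_ℂ • ξ⟫_ℂ = _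
  rw [inner_smul_right]

theorem norm_gnsTensorAction (z : VNElem 𝔸.N ⊗[ℂ] L) :
    ‖𝔸.gnsTensorAction z‖ = ‖𝔸.gnsTensor z‖ := by
  have key : ∀ z w : VNElem 𝔸.N ⊗[ℂ] L, ⟪𝔸.gnsTensorAction z, 𝔸.gnsTensorAction w⟫_ℂ =
      ⟪𝔸.gnsTensor z, 𝔸.gnsTensor w⟫_ℂ := by
    intro z w
    induction z with
    | zero => simp
    | add z z' hz hz' => simp only [map_add, inner_add_left, hz, hz']
    | tmul b ξ' =>
      induction w with
      | zero => simp
      | add w w' hw hw' => simp only [map_add, inner_add_right, hw, hw']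
      | tmul a ξ => exact 𝔸.inner_action a b ξ ξ'
  rw [norm_eq_sqrt_re_inner (𝕜 := ℂ), norm_eq_sqrt_re_inner (𝕜 := ℂ), key]

/-- Continuous maps on the Hilbert tensor product agree if they agree on all `Γ(a) ⊗ ξ`. -/
theorem gns_ext {E : Type*} [NormedAddCommGroup E] [NormedSpace ℂ E]
    {S T : HilbertTensor H L →L[ℂ] E}
    (h : ∀ (a : VNElem 𝔸.N) (ξ : L), S (insLeft ((a : H →L[ℂ] H) 𝔸.Ω) ξ) =
      T (insLeft ((a : H →L[ℂ] H) 𝔸.Ω) ξ)) : S = T := by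
  refine hilbertTensor_ext fun ζ ξ => ?_
  have h1 : (fun ζ : H => S (insRight ξ ζ)) = fun ζ => T (insRight ξ ζ) :=
    𝔸.cyclic.equalizer (by fun_prop) (by fun_prop) (funext fun a => h a ξ)
  exact congrFun h1 ζ

theorem denseRange_gnsTensor : DenseRange 𝔸.gnsTensor := by
  have h : (LinearMap.range 𝔸.gnsTensor).topologicalClosure = ⊤ := by
    rw [Submodule.topologicalClosure_eq_top_iff, Submodule.eq_bot_iff]
    intro z hz
    have h0 : innerSL ℂ z = 0 := 𝔸.gns_ext fun a ξ => by
      rw [innerSL_apply_apply, zero_apply]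
      exact Submodule.inner_left_of_mem_orthogonal
        (LinearMap.mem_range_self 𝔸.gnsTensor (a ⊗ₜ[ℂ] ξ)) hz
    have := congrArg (fun f => f z) h0
    simpa using this
  have h' := (Submodule.dense_iff_topologicalClosure_eq_top).2 h
  rwa [LinearMap.coe_range] at h'

theorem U_gns (a : VNElem 𝔸.N) (ξ : L) :
    𝔸.U (insLeft ((a : H →L[ℂ] H) 𝔸.Ω) ξ) =
      (𝔸.α a : HilbertTensor H L →L[ℂ] HilbertTensor H L) (insLeft 𝔸.Ω ξ) :=
  LinearMap.extendOfNorm_eq 𝔸.denseRange_gnsTensor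
    ⟨1, fun z => by rw [one_mul, norm_gnsTensorAction]⟩ (a ⊗ₜ[ℂ] ξ)

/-- The formula `(id ⊗ ω_{ξ,η})(U)Γ(a) = Γ((id ⊗ ω_{ξ,η})α(a))`. -/
theorem slice_U (a : VNElem 𝔸.N) (ξ η : L) :
    vecSliceRight ξ η 𝔸.U ((a : H →L[ℂ] H) 𝔸.Ω) =
      (sliceRightVec ξ η (𝔸.α a) : H →L[ℂ] H) 𝔸.Ω :=
  congrArg (insRight η).adjoint (𝔸.U_gns a ξ)

theorem U_comm (y : L →L[ℂ] L) (hy : y ∈ 𝔾.Linf.commutant) :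
    opTensor 1 y * 𝔸.U = 𝔸.U * opTensor 1 y := by
  refine 𝔸.gns_ext fun a ξ => ?_
  have h1 : ∀ (ζ : H) (ξ : L), (opTensor 1 y : HilbertTensor H L →L[ℂ] HilbertTensor H L)
      (insLeft ζ ξ) = insLeft ζ (y ξ) := fun ζ ξ =>
    congrArg (fun f => f ξ) (opTensor_comp_insLeft (1 : H →L[ℂ] H) y ζ)
  have h2 := congrArg (fun f => f (insLeft 𝔸.Ω ξ)) (vnTensor_comm_right (𝔸.α a) y hy)
  simp only [mul_apply_eq_comp] at h2 ⊢
  rw [h1, U_gns, U_gns, h2, h1]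

/-- The coefficient `(ω_{ζ,η} ⊗ id)(U) ∈ L^∞(𝔾)`. -/
def coefficient (ζ η : H) : VNElem 𝔾.Linf :=
  ⟨vecSliceLeft ζ η 𝔸.U, mem_of_comm_commutant 𝔾.Linf _ fun y hy =>
    vecSliceLeft_mul_comm ζ η _ y (𝔸.U_comm y hy)⟩

/-- Completely periodic vectors: `ζ` lies in a finite-dimensional subspace `V` of `H` that is
invariant under `U`, such that the restriction `u` of `U` to `V` and its transpose are invertible;
here `u` is written as the matrix of its coefficients with respect to an orthonormal basis. -/
def IsCompletelyPeriodic (ζ : H) : Prop :=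
  ∃ (V : Submodule ℂ H) (_ : FiniteDimensional ℂ V) (n : ℕ) (e : OrthonormalBasis (Fin n) ℂ V),
    ζ ∈ V ∧
    𝔸.U * opTensor V.starProjection 1 =
      opTensor V.starProjection 1 * 𝔸.U * opTensor V.starProjection 1 ∧
    IsUnit (Matrix.of fun i j => 𝔸.coefficient (e j : H) (e i : H)) ∧
    IsUnit (Matrix.of fun i j => 𝔸.coefficient (e j : H) (e i : H)).transpose

/-- The completely almost periodic vectors. -/
def HCAP : Submodule ℂ H := (Submodule.span ℂ {ζ | 𝔸.IsCompletelyPeriodic ζ}).topologicalClosure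

/-- The C*-algebra `C(ℍ)` of the canonical compactification `ℍ` of `𝔾`: the unital C*-subalgebra of
`L^∞(𝔾)` generated by the coefficients `(ω_{ζ,η} ⊗ id)(U)`, `ζ` completely almost periodic. Its
co-multiplication is the restriction of `Δ`. -/
def compactification : StarSubalgebra ℂ (VNElem 𝔾.Linf) :=
  (StarAlgebra.adjoin ℂ {x | ∃ ζ ∈ 𝔸.HCAP, ∃ η : H, x = 𝔸.coefficient ζ η}).topologicalClosure

/-- Co-commutativity of `ℍ`: the co-multiplication of `C(ℍ)` is invariant under the flip. -/
def IsCocommutative : Prop :=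
  ∀ x ∈ 𝔸.compactification,
    tensorFlip L ∘L (𝔾.Δ x : HilbertTensor L L →L[ℂ] HilbertTensor L L) ∘L tensorFlip L = 𝔾.Δ x

/-- `ℍ` is the dual of the discrete group `Γ`: the C*-algebra `C(ℍ)` is the closed linear span of a
copy of `Γ` in its unitary group, on which the co-multiplication is `λ_g ↦ λ_g ⊗ λ_g`. -/
def IsDualOfGroup (Γ : Type*) [Group Γ] : Prop :=
  ∃ lam : Γ →* unitary (VNElem 𝔾.Linf), Function.Injective lam ∧
    (∀ g, (𝔾.Δ (lam g) : HilbertTensor L L →L[ℂ] HilbertTensor L L) =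
      opTensor ((lam g : VNElem 𝔾.Linf) : L →L[ℂ] L) ((lam g : VNElem 𝔾.Linf) : L →L[ℂ] L)) ∧
    (𝔸.compactification : Set (VNElem 𝔾.Linf)) =
      closure (Submodule.span ℂ (Set.range fun g => (lam g : VNElem 𝔾.Linf)))

/-- Duals of discrete groups are co-commutative. -/
theorem IsDualOfGroup.isCocommutative {Γ : Type*} [Group Γ] (h : 𝔸.IsDualOfGroup Γ) :
    𝔸.IsCocommutative := by
  obtain ⟨lam, -, h1, h2⟩ := h
  intro x hx
  have hx' : x ∈ closure
      (Submodule.span ℂ (Set.range fun g => (lam g : VNElem 𝔾.Linf)) : Set (VNElem 𝔾.Linf)) :=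
    h2 ▸ hx
  have hc : Continuous fun x : VNElem 𝔾.Linf =>
      (𝔾.Δ x : HilbertTensor L L →L[ℂ] HilbertTensor L L) :=
    continuous_subtype_val.comp (starAlgHomL 𝔾.Δ).continuous
  refine closure_minimal (t := {x | tensorFlip L ∘L
    (𝔾.Δ x : HilbertTensor L L →L[ℂ] HilbertTensor L L) ∘L tensorFlip L = 𝔾.Δ x}) ?_
    (isClosed_eq (by fun_prop) hc) hx'
  intro y hy
  induction hy using Submodule.span_induction with
  | mem y hy =>
    obtain ⟨g, rfl⟩ := hy
    refine hilbertTensor_ext fun ζ ξ => ?_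
    simp [h1, tensorFlip, opTensor, insLeft_apply]
  | zero => simp
  | add a b _ _ ha hb =>
    simp only [Set.mem_ofPred_eq] at ha hb ⊢
    simp only [map_add, AddMemClass.coe_add, ContinuousLinearMap.add_comp,
      ContinuousLinearMap.comp_add, ha, hb]
  | smul c a _ ha =>
    simp only [Set.mem_ofPred_eq] at ha ⊢
    simp only [map_smul, SetLike.val_smul, ContinuousLinearMap.smul_comp,
      ContinuousLinearMap.comp_smul, ha]

end StatePreservingAction

end

/-! Co-commutativity forces every irreducible finite-dimensional co-representation of $\mathbb H$ to
be one-dimensional, so that $u$ is a single group-like unitary $g \in C(\mathbb H)$, $\Delta(g) = g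
\otimes g$. It then suffices to find an invariant mean that does not change under $x \mapsto g x
g^*$: for such a mean $m(xg) = m(g(xg)g^*) = m(gx)$, and $v = g$ works.

One-dimensionality (`IsIrreducible.eq_one`): pairing the flip-invariant sum $\Delta(u_{ij}) = \sum_k
u_{ik} \otimes u_{kj}$ with two vector functionals shows that the scalar matrices
$(\omega_{\xi,\eta}(u_{ij}))$ commute with one another. An eigenspace of one of them is invariant
under all, hence trivial by irreducibility, so all are scalar. Then every subspace of $\mathbb C^n$
is invariant, and $n = 1$.

The mean (`IsAmenable.exists_isInvariantMean_conjL`): since $\Delta(gxg^*) = (g \otimes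
g)\Delta(x)(g \otimes g)^*$, conjugation by $g$ carries invariant means to invariant means. Starting
from any invariant mean $m_0$, a weak* cluster point of the Cesàro averages of $m_0(g^k x g^{-k})$
is again an invariant mean, and it is fixed by the conjugation. -/

/-! ### Conjugation, normal functionals and slice maps -/

section Conjugation

variable {H K : Type*}
  [NormedAddCommGroup H] [InnerProductSpace ℂ H] [CompleteSpace H]
  [NormedAddCommGroup K] [InnerProductSpace ℂ K] [CompleteSpace K]

/-- The bounded linear map `x ↦ a x a*`. -/
noncomputable def conjL {M : VonNeumannAlgebra H} (a : VNElem M) : VNElem M →L[ℂ] VNElem M :=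
  (ContinuousLinearMap.mul ℂ (VNElem M)).flip (star a) ∘L ContinuousLinearMap.mul ℂ (VNElem M) a

theorem conjL_apply {M : VonNeumannAlgebra H} (a x : VNElem M) :
    conjL a x = a * x * star a := rfl

/-- Since $\langle a x a^* \xi_n, \eta_n\rangle = \langle x a^*\xi_n, a^*\eta_n\rangle$, the vectors
$a^*\xi_n$ and $a^*\eta_n$ represent the new functional; boundedness of $a^*$ keeps them
square-summable. -/
theorem IsNormalFunctional.comp_conjL {M : VonNeumannAlgebra H} {θ : StrongDual ℂ (VNElem M)}
    (hθ : IsNormalFunctional θ) (a : VNElem M) : IsNormalFunctional (θ ∘L conjL a) := by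
  obtain ⟨ξ, η, hξ, hη, h⟩ := hθ
  have key : ∀ ζ : ℕ → H, Summable (fun n => ‖ζ n‖ ^ 2) →
      Summable (fun n => ‖((star a : VNElem M) : H →L[ℂ] H) (ζ n)‖ ^ 2) := fun ζ hζ => by
    refine Summable.of_nonneg_of_le (fun n => by positivity) (fun n => ?_)
      (hζ.mul_left (‖((star a : VNElem M) : H →L[ℂ] H)‖ ^ 2))
    rw [← mul_pow]
    gcongr
    exact ContinuousLinearMap.le_opNorm _ _
  refine ⟨_, _, key ξ hξ, key η hη, fun x => ?_⟩
  have e : ∀ n, ⟪((star a : VNElem M) : H →L[ℂ] H) (η n),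
      (x : H →L[ℂ] H) (((star a : VNElem M) : H →L[ℂ] H) (ξ n))⟫_ℂ =
      ⟪η n, ((conjL a x : VNElem M) : H →L[ℂ] H) (ξ n)⟫_ℂ := fun n =>
    ContinuousLinearMap.adjoint_inner_left (a : H →L[ℂ] H) _ _
  simp only [e]
  exact h (conjL a x)

/-- Moving $a \otimes b$ past the insertion of a vector in the second leg lets $b^*$ act on that
vector and leaves $a$ outside. -/
theorem vecSliceRight_conj (ξ η : K) (a : H →L[ℂ] H) (b : K →L[ℂ] K)
    (X : HilbertTensor H K →L[ℂ] HilbertTensor H K) :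
    vecSliceRight ξ η (opTensor a b * X * star (opTensor a b)) =
      a * vecSliceRight (star b ξ) (star b η) X * star a := by
  have e1 : (insRight η).adjoint ∘L opTensor a b = a ∘L (insRight (star b η)).adjoint := by
    have := congrArg ContinuousLinearMap.adjoint (opTensor_comp_insRight (star a) (star b) η)
    simpa only [ContinuousLinearMap.adjoint_comp, opTensor_adjoint,
      ContinuousLinearMap.star_eq_adjoint, ContinuousLinearMap.adjoint_adjoint] using this
  have e2 := opTensor_comp_insRight (star a) (star b) ξ
  calc vecSliceRight ξ η (opTensor a b * X * star (opTensor a b))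
      = ((insRight η).adjoint ∘L opTensor a b) ∘L X ∘L
          (opTensor (star a) (star b) ∘L insRight ξ) := by
        rw [ContinuousLinearMap.star_eq_adjoint, opTensor_adjoint]; rfl
    _ = _ := by rw [e1, e2]; rfl

theorem vecSliceLeft_conj (ζ η : H) (a : H →L[ℂ] H) (b : K →L[ℂ] K)
    (X : HilbertTensor H K →L[ℂ] HilbertTensor H K) :
    vecSliceLeft ζ η (opTensor a b * X * star (opTensor a b)) =
      b * vecSliceLeft (star a ζ) (star a η) X * star b := by
  have e1 : (insLeft η).adjoint ∘L opTensor a b = b ∘L (insLeft (star a η)).adjoint := by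
    have := congrArg ContinuousLinearMap.adjoint (opTensor_comp_insLeft (star a) (star b) η)
    simpa only [ContinuousLinearMap.adjoint_comp, opTensor_adjoint,
      ContinuousLinearMap.star_eq_adjoint, ContinuousLinearMap.adjoint_adjoint] using this
  have e2 := opTensor_comp_insLeft (star a) (star b) ζ
  calc vecSliceLeft ζ η (opTensor a b * X * star (opTensor a b))
      = ((insLeft η).adjoint ∘L opTensor a b) ∘L X ∘L
          (opTensor (star a) (star b) ∘L insLeft ζ) := by
        rw [ContinuousLinearMap.star_eq_adjoint, opTensor_adjoint]; rfl
    _ = _ := by rw [e1, e2]; rfl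

/-- The sliced leg absorbs its conjugation into the functional, while the other leg keeps its own
outside. The relation `h` is between operators, so $a \otimes b$ need not be exhibited as an element
of `vnTensor M N`. -/
theorem sliceLeft_conj {M : VonNeumannAlgebra H} {N : VonNeumannAlgebra K}
    (θ : StrongDual ℂ (VNElem M)) (X Y : VNElem (vnTensor M N)) (a : VNElem M) (b : VNElem N)
    (h : (Y : HilbertTensor H K →L[ℂ] HilbertTensor H K) =
      opTensor (a : H →L[ℂ] H) (b : K →L[ℂ] K) *
        (X : HilbertTensor H K →L[ℂ] HilbertTensor H K) *
        star (opTensor (a : H →L[ℂ] H) (b : K →L[ℂ] K))) :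
    sliceLeft θ Y = conjL b (sliceLeft (θ ∘L conjL a) X) := by
  refine Subtype.ext (ContinuousLinearMap.ext fun ξ => ext_inner_left ℂ fun η => ?_)
  have e : sliceRightVec ξ η Y =
      conjL a (sliceRightVec (star (b : K →L[ℂ] K) ξ) (star (b : K →L[ℂ] K) η) X) :=
    Subtype.ext <| (congrArg (vecSliceRight ξ η) h).trans (vecSliceRight_conj ξ η _ _ _)
  rw [inner_sliceLeft, e]
  refine (inner_sliceLeft (θ ∘L conjL a) X (star (b : K →L[ℂ] K) ξ)
    (star (b : K →L[ℂ] K) η)).symm.trans ?_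
  exact ContinuousLinearMap.adjoint_inner_left (b : K →L[ℂ] K) _ _

theorem sliceRight_conj {M : VonNeumannAlgebra H} {N : VonNeumannAlgebra K}
    (θ : StrongDual ℂ (VNElem N)) (X Y : VNElem (vnTensor M N)) (a : VNElem M) (b : VNElem N)
    (h : (Y : HilbertTensor H K →L[ℂ] HilbertTensor H K) =
      opTensor (a : H →L[ℂ] H) (b : K →L[ℂ] K) *
        (X : HilbertTensor H K →L[ℂ] HilbertTensor H K) *
        star (opTensor (a : H →L[ℂ] H) (b : K →L[ℂ] K))) :
    sliceRight θ Y = conjL a (sliceRight (θ ∘L conjL b) X) := by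
  refine Subtype.ext (ContinuousLinearMap.ext fun ζ => ext_inner_left ℂ fun η => ?_)
  have e : sliceLeftVec ζ η Y =
      conjL b (sliceLeftVec (star (a : H →L[ℂ] H) ζ) (star (a : H →L[ℂ] H) η) X) :=
    Subtype.ext <| (congrArg (vecSliceLeft ζ η) h).trans (vecSliceLeft_conj ζ η _ _ _)
  rw [inner_sliceRight, e]
  refine (inner_sliceRight (θ ∘L conjL b) X (star (a : H →L[ℂ] H) ζ)
    (star (a : H →L[ℂ] H) η)).symm.trans ?_
  exact ContinuousLinearMap.adjoint_inner_left (a : H →L[ℂ] H) _ _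

end Conjugation

/-! ### Invariant means under conjugation by a group-like unitary -/

namespace HopfVonNeumannAlgebra

variable {L : Type*} [NormedAddCommGroup L] [InnerProductSpace ℂ L] [CompleteSpace L]
  {𝔾 : HopfVonNeumannAlgebra L}

/-- Multiplicativity of $\Delta$ turns conjugation by a group-like element into conjugation on both
legs, which is the input of `sliceLeft_conj` and `sliceRight_conj`. -/
theorem comul_conjL {g : VNElem 𝔾.Linf}
    (hg : (𝔾.Δ g : HilbertTensor L L →L[ℂ] HilbertTensor L L) =
      opTensor (g : L →L[ℂ] L) (g : L →L[ℂ] L)) (x : VNElem 𝔾.Linf) :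
    (𝔾.Δ (conjL g x) : HilbertTensor L L →L[ℂ] HilbertTensor L L) =
      opTensor (g : L →L[ℂ] L) (g : L →L[ℂ] L) * 𝔾.Δ x *
        star (opTensor (g : L →L[ℂ] L) (g : L →L[ℂ] L)) := by
  rw [conjL_apply, map_mul, map_mul, map_star, ← hg]
  rfl

/-- Conjugation by a group-like unitary preserves invariant means. -/
theorem IsInvariantMean.comp_conjL {m : StrongDual ℂ (VNElem 𝔾.Linf)} (hm : 𝔾.IsInvariantMean m)
    {g : VNElem 𝔾.Linf} (hu : g ∈ unitary (VNElem 𝔾.Linf))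
    (hg : (𝔾.Δ g : HilbertTensor L L →L[ℂ] HilbertTensor L L) =
      opTensor (g : L →L[ℂ] L) (g : L →L[ℂ] L)) :
    𝔾.IsInvariantMean (m ∘L conjL g) := by
  have h1 := Unitary.star_mul_self_of_mem hu
  have h2 := Unitary.mul_star_self_of_mem hu
  have h3 : ∀ θ : StrongDual ℂ (VNElem 𝔾.Linf), (θ ∘L conjL (star g)) ∘L conjL g = θ := fun θ => by
    ext x
    change θ (star g * (g * x * star g) * star (star g)) = θ x
    rw [star_star, mul_assoc, mul_assoc, h1, mul_one, ← mul_assoc, h1, one_mul]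
  have h4 : ∀ θ : StrongDual ℂ (VNElem 𝔾.Linf), (θ ∘L conjL (star g)) 1 = θ 1 := fun θ => by
    change θ (star g * 1 * star (star g)) = θ 1
    rw [star_star, mul_one, h1]
  refine ⟨?_, fun x => ?_, fun θ hθ x => ?_, fun θ hθ x => ?_⟩
  · change m (g * 1 * star g) = 1
    rw [mul_one, h2, hm.map_one]
  · have e : conjL g (star x * x) = star (x * star g) * (x * star g) := by
      rw [conjL_apply, star_mul, star_star]
      simp only [mul_assoc]
    change 0 ≤ m (conjL g (star x * x))
    rw [e]
    exact hm.nonneg _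
  -- Invariance is applied to the functional $\theta(g^* \cdot g)$ at the point $gxg^*$. The slice
  -- formula conjugates the functional back to $\theta$ and leaves one conjugation by $g$ outside;
  -- by unitarity both functionals agree at $1$.
  · have := hm.left_invariant _ (hθ.comp_conjL (star g)) (conjL g x)
    rwa [sliceLeft_conj _ _ _ _ _ (comul_conjL hg x), h3, h4] at this
  · have := hm.right_invariant _ (hθ.comp_conjL (star g)) (conjL g x)
    rwa [sliceRight_conj _ _ _ _ _ (comul_conjL hg x), h3, h4] at this

end HopfVonNeumannAlgebra

/-! ### Cesàro averages and weak* limits -/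

/-- Averaging a functional over the powers of a contraction and passing to a weak* limit. -/
theorem exists_ultrafilter_tendsto_average {E : Type*} [NormedAddCommGroup E] [NormedSpace ℂ E]
    (m₀ : StrongDual ℂ E) (T : E →L[ℂ] E) (hT : ∀ x, ‖T x‖ ≤ ‖x‖) :
    ∃ (f : Ultrafilter ℕ) (m : StrongDual ℂ E), (∀ x, m (T x) = m x) ∧
      ∀ x, Tendsto (fun N : ℕ => ((N : ℂ) + 1)⁻¹ * ∑ k ∈ Finset.range (N + 1), m₀ ((T ^ k) x))
        f (𝓝 (m x)) := by
  have hpow : ∀ (k : ℕ) (x : E), ‖m₀ ((T ^ k) x)‖ ≤ ‖m₀‖ * ‖x‖ := fun k x => by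
    refine (m₀.le_opNorm _).trans (mul_le_mul_of_nonneg_left ?_ (norm_nonneg _))
    induction k with
    | zero => simp
    | succ k ih =>
      rw [pow_succ']
      exact (hT _).trans ih
  have hN : ∀ N : ℕ, ‖((N : ℂ) + 1)⁻¹‖ = ((N : ℝ) + 1)⁻¹ := fun N => by
    rw [norm_inv, ← Nat.cast_succ, Complex.norm_natCast, Nat.cast_succ]
  -- The average runs over the $N + 1$ powers $0, \dots, N$, so the denominator never vanishes.
  let a : ℕ → StrongDual ℂ E := fun N =>
    ((N : ℂ) + 1)⁻¹ • ∑ k ∈ Finset.range (N + 1), m₀ ∘L (T ^ k)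
  have ha : ∀ N x, a N x = ((N : ℂ) + 1)⁻¹ * ∑ k ∈ Finset.range (N + 1), m₀ ((T ^ k) x) :=
    fun N x => by simp [a]
  have hball : ∀ N, ‖a N‖ ≤ ‖m₀‖ := fun N => by
    refine ContinuousLinearMap.opNorm_le_bound _ (norm_nonneg _) fun x => ?_
    rw [ha, norm_mul, hN, inv_mul_le_iff₀ (by positivity)]
    refine (norm_sum_le_of_le _ fun k _ => hpow k x).trans_eq ?_
    simp
  -- A non-principal ultrafilter refines `atTop`, so error terms of order $1/N$ still vanish along
  -- it; Banach–Alaoglu gives a limit of all averages at once.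
  let f : Ultrafilter ℕ := hyperfilter ℕ
  have hf : (f : Filter ℕ) ≤ atTop := Nat.hyperfilter_le_atTop
  obtain ⟨m, -, hm⟩ := (WeakDual.isCompact_closedBall (𝕜 := ℂ) (0 : StrongDual ℂ E)
    ‖m₀‖).ultrafilter_le_nhds (f.map fun N => StrongDual.toWeakDual (a N)) <| by
      refine le_principal_iff.2 (mem_map.2 (univ_mem' fun N => ?_))
      simpa using hball N
  have hlim : ∀ x, Tendsto (fun N => a N x) f (𝓝 (m x)) := fun x =>
    ((WeakDual.eval_continuous x).tendsto m).comp hm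
  refine ⟨f, WeakDual.toStrongDual m, fun x => ?_, fun x => (hlim x).congr fun N => ha N x⟩
  -- The difference telescopes to $(m_0(T^{N+1}x) - m_0(x))/(N+1)$, of norm at most
  -- $2\|m_0\|\|x\|/(N+1)$.
  have h0 : Tendsto (fun N => a N (T x) - a N x) f (𝓝 0) := by
    refine squeeze_zero_norm (a := fun N : ℕ => (2 * (‖m₀‖ * ‖x‖)) * ((N : ℝ) + 1)⁻¹)
      (fun N => ?_) ?_
    · have e : a N (T x) - a N x = ((N : ℂ) + 1)⁻¹ * (m₀ ((T ^ (N + 1)) x) - m₀ ((T ^ 0) x)) := by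
        rw [ha, ha, ← mul_sub, ← Finset.sum_sub_distrib,
          ← Finset.sum_range_sub (fun k => m₀ ((T ^ k) x))]
        simp only [pow_succ]
        rfl
      rw [e, norm_mul, hN, mul_comm]
      gcongr
      refine (norm_sub_le _ _).trans ?_
      linarith [hpow (N + 1) x, hpow 0 x]
    · have := (tendsto_one_div_add_atTop_nhds_zero_nat (𝕜 := ℝ)).const_mul (2 * (‖m₀‖ * ‖x‖))
      simp only [one_div, mul_zero] at this
      exact this.mono_left hf
  exact sub_eq_zero.1 (tendsto_nhds_unique ((hlim (T x)).sub (hlim x)) h0)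

/-! ### An invariant mean fixed by conjugation -/

namespace HopfVonNeumannAlgebra

variable {L : Type*} [NormedAddCommGroup L] [InnerProductSpace ℂ L] [CompleteSpace L]
  {𝔾 : HopfVonNeumannAlgebra L}

/-- On an amenable `𝔾` there is an invariant mean that commutes with a given group-like unitary. -/
theorem IsAmenable.exists_isInvariantMean_conjL (h : 𝔾.IsAmenable)
    {g : VNElem 𝔾.Linf} (hu : g ∈ unitary (VNElem 𝔾.Linf))
    (hg : (𝔾.Δ g : HilbertTensor L L →L[ℂ] HilbertTensor L L) =
      opTensor (g : L →L[ℂ] L) (g : L →L[ℂ] L)) :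
    ∃ m, 𝔾.IsInvariantMean m ∧ ∀ x, m (conjL g x) = m x := by
  obtain ⟨m₀, h₀⟩ := h
  have hk : ∀ k : ℕ, 𝔾.IsInvariantMean (m₀ ∘L (conjL g) ^ k) := fun k => by
    induction k with
    | zero => exact h₀
    | succ k ih => exact ih.comp_conjL hu hg
  obtain ⟨f, m, hinv, hlim⟩ := exists_ultrafilter_tendsto_average m₀ (conjL g) fun x => by
    rw [conjL_apply, CStarRing.norm_mul_mem_unitary _ (Unitary.star_mem hu),
      CStarRing.norm_mem_unitary_mul _ hu]
  -- A linear relation with a constant scalar that holds for every term passes to the averages and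
  -- to the limit. Both invariance conditions have this form, with $c = \theta(1)$.
  have hconst : ∀ (x y : VNElem 𝔾.Linf) (c : ℂ),
      (∀ k : ℕ, m₀ ((conjL g ^ k) y) = c * m₀ ((conjL g ^ k) x)) → m y = c * m x :=
    fun x y c hc => by
      refine tendsto_nhds_unique (hlim y) (((hlim x).const_mul c).congr fun N => ?_)
      rw [Finset.sum_congr rfl fun k _ => hc k, ← Finset.mul_sum]
      ring
  refine ⟨m, ⟨?_, fun x => ?_, fun θ hθ x => ?_, fun θ hθ x => ?_⟩, hinv⟩
  · refine tendsto_nhds_unique (hlim 1) (tendsto_const_nhds.congr fun N => ?_)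
    have e : ∀ k : ℕ, m₀ ((conjL g ^ k) 1) = 1 := fun k => (hk k).map_one
    rw [Finset.sum_congr rfl fun k _ => e k, Finset.sum_const, Finset.card_range,
      nsmul_one, Nat.cast_succ, inv_mul_cancel₀ (Nat.cast_add_one_ne_zero N)]
  · refine ge_of_tendsto' (hlim (star x * x)) fun N => mul_nonneg ?_
      (Finset.sum_nonneg fun k _ => (hk k).nonneg x)
    rw [← Nat.cast_succ, ← Complex.ofReal_natCast, ← Complex.ofReal_inv]
    exact Complex.zero_le_real.2 (by positivity)
  · exact hconst _ _ _ fun k => (hk k).left_invariant θ hθ x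
  · exact hconst _ _ _ fun k => (hk k).right_invariant θ hθ x

/-! ### Scalar coefficient matrices of a co-representation -/

/-- The matrix of the vector functional `ω_{ξ,η}` applied to the entries of `u`. -/
noncomputable def vecMatrix {n : ℕ} (u : Matrix (Fin n) (Fin n) (VNElem 𝔾.Linf)) (ξ η : L) :
    Matrix (Fin n) (Fin n) ℂ :=
  Matrix.of fun i j => ⟪η, (u i j : L →L[ℂ] L) ξ⟫_ℂ

theorem vecMatrix_mul_map {n : ℕ} (u : Matrix (Fin n) (Fin n) (VNElem 𝔾.Linf)) (ξ η : L)
    (p : Matrix (Fin n) (Fin n) ℂ) :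
    vecMatrix (u * p.map (algebraMap ℂ (VNElem 𝔾.Linf))) ξ η = vecMatrix u ξ η * p := by
  ext i j
  simp [vecMatrix, Matrix.mul_apply, Algebra.algebraMap_eq_smul_one, mul_comm]

theorem vecMatrix_map_mul {n : ℕ} (u : Matrix (Fin n) (Fin n) (VNElem 𝔾.Linf)) (ξ η : L)
    (p : Matrix (Fin n) (Fin n) ℂ) :
    vecMatrix (p.map (algebraMap ℂ (VNElem 𝔾.Linf)) * u) ξ η = p * vecMatrix u ξ η := by
  ext i j
  simp [vecMatrix, Matrix.mul_apply, Algebra.algebraMap_eq_smul_one]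

/-- Vector functionals separate operators, so identities over $L^\infty(\mathbb G)$ can be checked
on scalar matrices. -/
theorem vecMatrix_injective {n : ℕ} {u v : Matrix (Fin n) (Fin n) (VNElem 𝔾.Linf)}
    (h : ∀ ξ η : L, vecMatrix u ξ η = vecMatrix v ξ η) : u = v := by
  refine Matrix.ext fun i j => Subtype.ext <| ContinuousLinearMap.ext fun ξ => ext_inner_left ℂ fun η =>
      congrFun (congrFun (h ξ η) i) j

/-- This transfers irreducibility from the operator-valued matrix to the family of its scalar
matrices, where linear algebra on $\mathbb C^n$ applies. -/
theorem IsIrreducible.eq_zero_or_one {n : ℕ} {u : Matrix (Fin n) (Fin n) (VNElem 𝔾.Linf)}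
    (hu : 𝔾.IsIrreducible u) {p : Matrix (Fin n) (Fin n) ℂ} (hp : IsStarProjection p)
    (h : ∀ ξ η : L, vecMatrix u ξ η * p = p * vecMatrix u ξ η * p) : p = 0 ∨ p = 1 :=
  hu.2 p hp <| vecMatrix_injective fun ξ η => by
    rw [vecMatrix_mul_map, vecMatrix_mul_map, vecMatrix_map_mul, h]

/-- The flip exchanges the legs of an elementary tensor. -/
theorem tensorFlip_conj_opTensor (x y : L →L[ℂ] L) :
    tensorFlip L ∘L opTensor x y ∘L tensorFlip L = opTensor y x :=
  hilbertTensor_ext fun ζ ξ => by simp [tensorFlip, opTensor, insLeft_apply]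

theorem inner_opTensor (x y : L →L[ℂ] L) (ξ η ξ' η' : L) :
    ⟪(insLeft η η' : HilbertTensor L L), opTensor x y (insLeft ξ ξ')⟫_ℂ =
      ⟪η, x ξ⟫_ℂ * ⟪η', y ξ'⟫_ℂ := by
  simp [opTensor, insLeft_apply, TensorProduct.inner_tmul]

/-- The matrices of a co-representation with flip-invariant co-multiplication commute. -/
theorem IsCorepresentation.commute_vecMatrix {n : ℕ}
    {u : Matrix (Fin n) (Fin n) (VNElem 𝔾.Linf)} (hu : 𝔾.IsCorepresentation u)
    (hflip : ∀ i j, tensorFlip L ∘L (𝔾.Δ (u i j) : HilbertTensor L L →L[ℂ] HilbertTensor L L) ∘L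
      tensorFlip L = 𝔾.Δ (u i j)) (ξ η ξ' η' : L) :
    Commute (vecMatrix u ξ η) (vecMatrix u ξ' η') := by
  ext i j
  have h := hflip i j
  rw [hu i j] at h
  simp only [ContinuousLinearMap.finsetSum_comp, ContinuousLinearMap.comp_finsetSum,
    tensorFlip_conj_opTensor] at h
  -- Write $A$, $B$ for the matrices of $\omega_{\xi,\eta}$, $\omega_{\xi',\eta'}$. Pairing with
  -- $\omega_{\xi,\eta} \otimes \omega_{\xi',\eta'}$ gives $(AB)_{ij}$ on the unflipped side and
  -- $\sum_k A_{kj}B_{ik} = (BA)_{ij}$ on the flipped one.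
  have h' := congrArg (fun T => ⟪(insLeft η η' : HilbertTensor L L), T (insLeft ξ ξ')⟫_ℂ) h
  simp only [sum_apply, inner_sum, inner_opTensor] at h'
  simp only [Matrix.mul_apply, vecMatrix, Matrix.of_apply]
  rw [← h']
  exact Finset.sum_congr rfl fun k _ => mul_comm _ _

end HopfVonNeumannAlgebra

/-! ### Commuting irreducible families of matrices -/

/-- The members of a commuting family of matrices without common invariant subspaces are scalar. -/
theorem Matrix.exists_eq_smul_one_of_commute {ι : Type*} {n : ℕ} (hn : 0 < n)
    (T : ι → Matrix (Fin n) (Fin n) ℂ) (hcomm : ∀ i j, Commute (T i) (T j))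
    (hirr : ∀ p : Matrix (Fin n) (Fin n) ℂ, IsStarProjection p →
      (∀ i, T i * p = p * T i * p) → p = 0 ∨ p = 1) (i : ι) :
    ∃ μ : ℂ, T i = μ • 1 := by
  have : Nonempty (Fin n) := ⟨⟨0, hn⟩⟩
  let Φ := Matrix.toEuclideanCLM (n := Fin n) (𝕜 := ℂ)
  obtain ⟨μ, hμ⟩ := Module.End.exists_eigenvalue
    (Φ (T i) : EuclideanSpace ℂ (Fin n) →ₗ[ℂ] EuclideanSpace ℂ (Fin n))
  let V := Module.End.eigenspace
    (Φ (T i) : EuclideanSpace ℂ (Fin n) →ₗ[ℂ] EuclideanSpace ℂ (Fin n)) μ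
  have hV : ∀ x, x ∈ V ↔ Φ (T i) x = μ • x := fun x => Module.End.mem_eigenspace_iff
  have hΦ : Function.Injective Φ := EquivLike.injective Φ
  -- The orthogonal projection onto the eigenspace is read back as a matrix; $\Phi$ respects
  -- products and adjoints, so this matrix is a star projection.
  obtain ⟨p, hp⟩ := EquivLike.surjective Φ V.starProjection
  have hproj : IsStarProjection p := by
    have h := isStarProjection_starProjection (U := V)
    refine ⟨hΦ ?_, hΦ ?_⟩
    · rw [map_mul, hp]
      exact h.isIdempotentElem
    · rw [map_star, hp]
      exact h.isSelfAdjoint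
  -- Each $T_j$ commutes with $T_i$ and hence maps the eigenspace of $T_i$ into itself.
  have hinv : ∀ j, T j * p = p * T j * p := fun j => by
    refine hΦ ?_
    rw [map_mul, map_mul, map_mul, hp]
    ext1 x
    have hx := (hV _).1 (V.starProjection_apply_mem x)
    refine (Submodule.starProjection_eq_self_iff.2 ((hV _).2 ?_)).symm
    have hc := congrArg (fun A => Φ A (V.starProjection x)) (hcomm i j).eq
    simp only [map_mul] at hc
    exact hc.trans ((congrArg (Φ (T j)) hx).trans (map_smul _ _ _))
  -- The value $p = 0$ would make the eigenspace trivial, contradicting the choice of $\mu$; for $p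
  -- = 1$ the eigenspace is everything.
  rcases hirr p hproj hinv with rfl | rfl
  · rw [map_zero] at hp
    refine absurd ((Submodule.eq_bot_iff _).2 fun x hx => ?_) hμ
    rw [← Submodule.starProjection_eq_self_iff.2 hx]
    exact congrArg (fun P => P x) hp.symm
  · rw [map_one] at hp
    refine ⟨μ, hΦ ?_⟩
    rw [map_smul, map_one]
    ext1 x
    exact (hV x).1 (Submodule.starProjection_eq_self_iff.1 (congrArg (fun P => P x) hp.symm))

/-! ### One-dimensionality of irreducible co-representations -/

namespace HopfVonNeumannAlgebra

variable {L : Type*} [NormedAddCommGroup L] [InnerProductSpace ℂ L] [CompleteSpace L]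
  {𝔾 : HopfVonNeumannAlgebra L}

/-- Irreducible co-representations with flip-invariant co-multiplication are one-dimensional. -/
theorem IsIrreducible.eq_one {n : ℕ} {u : Matrix (Fin n) (Fin n) (VNElem 𝔾.Linf)}
    (hirr : 𝔾.IsIrreducible u) (hu : 𝔾.IsCorepresentation u)
    (hflip : ∀ i j, tensorFlip L ∘L (𝔾.Δ (u i j) : HilbertTensor L L →L[ℂ] HilbertTensor L L) ∘L
      tensorFlip L = 𝔾.Δ (u i j)) : n = 1 := by
  have hscalar := Matrix.exists_eq_smul_one_of_commute hirr.1
    (fun z : L × L => vecMatrix u z.1 z.2)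
    (fun z w => hu.commute_vecMatrix hflip z.1 z.2 w.1 w.2)
    fun p hp h => hirr.eq_zero_or_one hp fun ξ η => h (ξ, η)
  let e : Fin n := ⟨0, hirr.1⟩
  -- Scalar matrices leave every subspace invariant, in particular the first coordinate line. Its
  -- projection is nonzero, so it must be $1$, which fails at the second diagonal entry as soon as
  -- $n > 1$.
  let p : Matrix (Fin n) (Fin n) ℂ := Matrix.diagonal (Pi.single e 1)
  have hidem : p * p = p := by
    rw [Matrix.diagonal_mul_diagonal']
    congr 1
    ext i
    by_cases h : i = e <;> simp [h]
  have hp : IsStarProjection p := by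
    refine ⟨hidem, ?_⟩
    rw [isSelfAdjoint_iff, Matrix.star_eq_conjTranspose, Matrix.diagonal_conjTranspose,
      Pi.star_single, star_one]
  have hpe : p e e = 1 := by simp [p]
  rcases hirr.eq_zero_or_one hp fun ξ η => by
    obtain ⟨μ, hμ⟩ := hscalar (ξ, η)
    change vecMatrix u ξ η = μ • 1 at hμ
    rw [hμ, mul_smul_comm, mul_one, smul_mul_assoc, smul_mul_assoc, one_mul, hidem] with h | h
  · simp [h] at hpe
  · by_contra hn
    have h1 : 1 < n := by have := hirr.1; omega
    have h2 := congrFun (congrFun h ⟨1, h1⟩) ⟨1, h1⟩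
    simp [p, e] at h2

end HopfVonNeumannAlgebra

/-! ### The proposition -/

theorem mainTheorem10 {L H : Type*}
    [NormedAddCommGroup L] [InnerProductSpace ℂ L] [CompleteSpace L]
    [NormedAddCommGroup H] [InnerProductSpace ℂ H] [CompleteSpace H]
    (𝔾 : HopfVonNeumannAlgebra L) (h_amenable : 𝔾.IsAmenable) (h_coamenable : 𝔾.IsCoamenable)
    (𝔸 : StatePreservingAction 𝔾 H) (h_unital : 𝔸.IsApproximatelyUnital)
    (h_cocomm : 𝔸.IsCocommutative)
    (n : ℕ) (u : Matrix (Fin n) (Fin n) (VNElem 𝔾.Linf))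
    (hu_mem : ∀ i j, u i j ∈ 𝔸.compactification)
    (hu_corep : 𝔾.IsCorepresentation u)
    (hu_unitary : u ∈ unitary (Matrix (Fin n) (Fin n) (VNElem 𝔾.Linf)))
    (hu_irred : 𝔾.IsIrreducible u) :
    ∃ m : StrongDual ℂ (VNElem 𝔾.Linf), 𝔾.IsInvariantMean m ∧
      ∀ i j, ∃ v ∈ 𝔸.compactification, ∀ x : VNElem 𝔾.Linf, m (x * u i j) = m (v * x) := by
  have hflip := fun i j => h_cocomm (u i j) (hu_mem i j)
  obtain rfl := hu_irred.eq_one hu_corep hflip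
  have hg : (𝔾.Δ (u 0 0) : HilbertTensor L L →L[ℂ] HilbertTensor L L) =
      opTensor (u 0 0 : L →L[ℂ] L) (u 0 0 : L →L[ℂ] L) := by
    simpa using hu_corep 0 0
  have hu : u 0 0 ∈ unitary (VNElem 𝔾.Linf) := by
    rw [Unitary.mem_iff] at hu_unitary ⊢
    have h1 := congrFun (congrFun hu_unitary.1 0) 0
    have h2 := congrFun (congrFun hu_unitary.2 0) 0
    simp only [Matrix.mul_apply, Finset.univ_unique, Finset.sum_singleton, Matrix.star_apply,
      Matrix.one_apply_eq, Fin.default_eq_zero] at h1 h2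
    exact ⟨h1, h2⟩
  obtain ⟨m, hm, hinv⟩ := h_amenable.exists_isInvariantMean_conjL hu hg
  -- With $g$ the only entry of $u$, invariance at $xg$ reads $m(xg) = m(g\,xg\,g^*) = m(gx)$, so $v
  -- = g$.
  refine ⟨m, hm, fun i j => ⟨u 0 0, hu_mem 0 0, fun x => ?_⟩⟩
  rw [Subsingleton.elim i 0, Subsingleton.elim j 0, ← hinv (x * u 0 0), conjL_apply, mul_assoc,
    mul_assoc, Unitary.mul_star_self_of_mem hu, mul_one]
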